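/- **Setting.** Let $(\Omega,\mathcal A,\mathbb P)$ be a probability space, $p\in[1,\infty)$, and let $(Y_n,Z_n)_{n\ge 1}$ be an independent sequence of random vectors with $Y_n\in L^p_+$ (claims) and $Z_n\in L^\infty_+$ (premium income). Let $$\mathcal F=\{f:\mathbb R_+\to\mathbb R_+ \mid f(t)\le t \text{ for all } t,\ f \text{ and } \mathrm{id}-f \text{ increasing}\}$$ be the set of retained loss functions, with the topology of compact convergence and its Borel $\sigma$-algebra. For $n\in\mathbb N_0$ let $\pi_{R,n}:L^p_+\to\bar{\mathbb R}$ be a law-invariant, monotone, normalized ($\pi_{R,n}(0)=0$) premium principle with the Fatou property and $\pi_{R,n}(Y_{n+1})<\infty$; write $\pi_{R,n}(f)=\pi_{R,n}(Y_{n+1}-f(Y_{n+1}))$ for $f\in\mathcal F$. The admissible actions are either $D_n(x)=\mathcal F$ for all $n$, $x$ (unconstrained case) or $D_n(x)=\{f\in\mathcal F:\pi_{R,n}(f)\le x^+\}$ for all $n$, $x$ (budget-constrained case). Let $\beta\in(0,1]$ and let $N\in\mathbb N_0$ be the planning horizon. Let $\rho_0,\dots,\rho_{N-1}:L^p\to\bar{\mathbb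 R}$ be law-invariant, monotone, translation invariant ($\rho_n(X+m)=\rho_n(X)+m$ for $m\in\mathbb R$), normalized risk measures with the Fatou property such that $\rho_n(\lambda Y_{n+1})<\infty$ for all $\lambda\ge0$ and $n<N$. Here a functional $\rho$ has the Fatou property if $\liminf_k\rho(X_k)\ge\rho(X)$ whenever $X_k\to X$ a.s. and $|X_k|\le W$ a.s. for all $k$, where $X_k$, $X$, $W$ lie in $L^p$ (for premium principles, in $L^p_+$). **Policies and values.** Let $\mathcal H_n$ be the set of histories $h_n=(x_0,f_0,x_1,\dots,f_{n-1},x_n)$ with $x_k\in\mathbb R$ and $f_k\in D_k(x_k)$, with the $\sigma$-algebra induced by the product of the Borel $\sigma$-algebras. A decision rule at time $n$ is a measurable map $d_n:\mathcal H_n\to\mathcal F$ with $d_n(h_n)\in D_n(x_n)$; it is Markov if it depends on $h_n$ only through $x_n$, as a measurable function of $x_n$. Let $\Pi$ and $\Pi^M$ be the sets of $N$-stage policies $\pi=(d_0,\dots,d_{N-1})$ of decision rules and of Markov decision rules, respectively. For $v:\mathbb R\to\mathbb R$, $n<N$, $x\in\mathbb R$, $f\in D_n(x)$ and a Markov decision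 rule $d$ at time $n$ put $$L_nv(x,f)=\rho_n\Big(f(Y_{n+1})+\pi_{R,n}(f)-Z_{n+1}-x+\beta\, v\big(x+Z_{n+1}-f(Y_{n+1})-\pi_{R,n}(f)\big)\Big),$$ $$\mathcal T_{n,d}v(x)=L_nv(x,d(x)),\qquad \mathcal T_nv(x)=\inf_{f\in D_n(x)}L_nv(x,f).$$ The value of $\pi\in\Pi$ is defined by $V_{N\pi}=0$ and $V_{n\pi}(h_n)=L_n\big(x'\mapsto V_{n+1\,\pi}(h_n,d_n(h_n),x')\big)(x_n,d_n(h_n))$ for $n<N$; for $\pi\in\Pi^M$ put $J_{N\pi}=0$ and $J_{n\pi}=\mathcal T_{n,d_n}J_{n+1\,\pi}$. The value functions are $V_n(h_n)=\inf_{\pi\in\Pi}V_{n\pi}(h_n)$ and $J_n(x)=\inf_{\pi\in\Pi^M}J_{n\pi}(x)$. It is assumed that the risk measures are such that $V_{n\pi}$ is measurable on $\mathcal H_n$ for all $\pi\in\Pi$ and $n\le N$. **Bounds.** Let $a_N=\underline c_N=\bar c_N=0$ and, for $n<N$, $a_n=1+\beta a_{n+1}$, $\underline c_n=a_n\operatorname{ess\,sup}(Z_{n+1})+\beta\underline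 c_{n+1}$ and $\bar c_n=\rho_n(a_nY_{n+1})+a_n\pi_{R,n}(Y_{n+1})+\beta\bar c_{n+1}$. Let $\mathbb B_n$ be the set of decreasing, lower semicontinuous $v:\mathbb R\to\mathbb R$ with $$-\underline c_n-a_nx^+\le v(x)\le\bar c_n+a_nx^-\qquad\text{for all }x\in\mathbb R.$$ **Theorem.** All policy values are well defined: for every $\pi\in\Pi$, $n<N$ and $h_n\in\mathcal H_n$, the argument of $\rho_n$ in the definition of $V_{n\pi}(h_n)$ lies in $L^p$ and $V_{n\pi}(h_n)$ is finite. For $n=0,\dots,N$ the value function depends only on the current surplus, $V_n(h_n)=J_n(x_n)$ for all $h_n\in\mathcal H_n$, and $J_n\in\mathbb B_n$. The Bellman equation holds: $J_N=0$ and $J_n=\mathcal T_nJ_{n+1}$ for $n=0,\dots,N-1$. For every $n<N$ there exists a Markov decision rule $d_n^*$ with $\mathcal T_{n,d_n^*}J_{n+1}=\mathcal T_nJ_{n+1}$, and every sequence of such minimizers is an optimal policy $\pi^*=(d_0^*,\dots,d_{N-1}^*)$: $V_{n\pi^*}(h_n)=V_n(h_n)$ for all $n\le N$ and $h_n\in\mathcal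 H_n$, in particular $V_{0\pi^*}(x)=V_0(x)$ for all $x\in\mathbb R$. -/

import Mathlib

open MeasureTheory ProbabilityTheory Filter Topology
open scoped NNReal ENNReal

noncomputable section

/-! ### Risk measures and premium principles -/

/-- `X` is a real random variable with integrable `p`-th moment, i.e. an element of `L^p`. -/
def IsLpRV {Ω : Type*} [MeasurableSpace Ω] (p : ℝ≥0∞) (P : Measure Ω) (X : Ω → ℝ) : Prop :=
  Measurable X ∧ MemLp X p P

/-- `X` is a non-negative random variable with integrable `p`-th moment, i.e. an element of
`L^p_+`. -/
def IsLpPosRV {Ω : Type*} [MeasurableSpace Ω] (p : ℝ≥0∞) (P : Measure Ω) (X : Ω → ℝ≥0) : Prop :=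
  Measurable X ∧ MemLp (fun ω => (X ω : ℝ)) p P

/-- A law-invariant, normalized monetary (monotone and translation invariant) risk measure
`ρ : L^p → [-∞, ∞]` with the Fatou property. Only the values of `ρ` on `L^p` are relevant; the
values at other functions are arbitrary and never used. -/
structure IsFatouMonetaryRiskMeasure {Ω : Type*} [MeasurableSpace Ω] (p : ℝ≥0∞) (P : Measure Ω)
    (ρ : (Ω → ℝ) → EReal) : Prop where
  law_invariant : ∀ X X' : Ω → ℝ, IsLpRV p P X → IsLpRV p P X' →
    P.map X = P.map X' → ρ X = ρ X'
  monotone : ∀ X X' : Ω → ℝ, IsLpRV p P X → IsLpRV p P X' →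
    (∀ᵐ ω ∂P, X ω ≤ X' ω) → ρ X ≤ ρ X'
  translation_invariant : ∀ (X : Ω → ℝ) (m : ℝ), IsLpRV p P X →
    ρ (fun ω => X ω + m) = ρ X + (m : EReal)
  normalized : ρ (fun _ => 0) = 0
  fatou : ∀ (X : ℕ → Ω → ℝ) (Xlim bd : Ω → ℝ),
    (∀ k, IsLpRV p P (X k)) → IsLpRV p P Xlim → IsLpRV p P bd →
    (∀ k, ∀ᵐ ω ∂P, |X k ω| ≤ bd ω) →
    (∀ᵐ ω ∂P, Tendsto (fun k => X k ω) atTop (𝓝 (Xlim ω))) →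
    ρ Xlim ≤ liminf (fun k => ρ (X k)) atTop

/-- A law-invariant, monotone and normalized premium principle `L^p_+ → [-∞, ∞]` with the Fatou
property. Only the values on `L^p_+` are relevant. -/
structure IsFatouPremiumPrinciple {Ω : Type*} [MeasurableSpace Ω] (p : ℝ≥0∞) (P : Measure Ω)
    (prem : (Ω → ℝ≥0) → EReal) : Prop where
  law_invariant : ∀ X X' : Ω → ℝ≥0, IsLpPosRV p P X → IsLpPosRV p P X' →
    P.map X = P.map X' → prem X = prem X'
  monotone : ∀ X X' : Ω → ℝ≥0, IsLpPosRV p P X → IsLpPosRV p P X' →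
    (∀ᵐ ω ∂P, X ω ≤ X' ω) → prem X ≤ prem X'
  normalized : prem (fun _ => 0) = 0
  fatou : ∀ (X : ℕ → Ω → ℝ≥0) (Xlim bd : Ω → ℝ≥0),
    (∀ k, IsLpPosRV p P (X k)) → IsLpPosRV p P Xlim → IsLpPosRV p P bd →
    (∀ k, ∀ᵐ ω ∂P, X k ω ≤ bd ω) →
    (∀ᵐ ω ∂P, Tendsto (fun k => X k ω) atTop (𝓝 (Xlim ω))) →
    prem Xlim ≤ liminf (fun k => prem (X k)) atTop

/-! ### Retained loss functions -/

/-- The set `𝓕` of retained loss functions `f : ℝ₊ → ℝ₊`: `f(t) ≤ t`, and both `f` and `id - f`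
are increasing. (The subtraction of `ℝ≥0` is the true one because `f t ≤ t`.) -/
def RetainedLoss : Type :=
  {f : ℝ≥0 → ℝ≥0 // (∀ t, f t ≤ t) ∧ Monotone f ∧ Monotone (fun t => t - f t)}

namespace RetainedLoss

instance : CoeFun RetainedLoss (fun _ => ℝ≥0 → ℝ≥0) := ⟨fun f => f.1⟩

theorem lipschitz (f : RetainedLoss) : LipschitzWith 1 (f : ℝ≥0 → ℝ≥0) := by
  obtain ⟨f, h1, h2, h3⟩ := f
  have key : ∀ s t : ℝ≥0, s ≤ t → |(f s : ℝ) - f t| ≤ |(s : ℝ) - t| := by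
    intro s t hst
    have a2 : (f s : ℝ) ≤ f t := by exact_mod_cast h2 hst
    have a3 : ((s - f s : ℝ≥0) : ℝ) ≤ ((t - f t : ℝ≥0) : ℝ) := by exact_mod_cast h3 hst
    rw [NNReal.coe_sub (h1 s), NNReal.coe_sub (h1 t)] at a3
    have a4 : (s : ℝ) ≤ t := by exact_mod_cast hst
    rw [abs_of_nonpos (by linarith), abs_of_nonpos (by linarith)]
    linarith
  refine LipschitzWith.of_dist_le_mul fun s t => ?_
  rw [NNReal.dist_eq, NNReal.dist_eq]
  simp only [NNReal.coe_one, one_mul]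
  rcases le_total s t with h | h
  · exact key s t h
  · rw [abs_sub_comm, abs_sub_comm (s : ℝ)]
    exact key t s h

/-- Retained loss functions, viewed in the space `C(ℝ₊)` of continuous functions. -/
def toContinuousMap (f : RetainedLoss) : C(ℝ≥0, ℝ) :=
  ⟨fun t => (f t : ℝ), NNReal.continuous_coe.comp f.lipschitz.continuous⟩

/-- `𝓕` carries the topology of compact convergence, as a subset of `C(ℝ₊)`. -/
instance : TopologicalSpace RetainedLoss :=
  TopologicalSpace.induced toContinuousMap inferInstance

/-- `𝓕` carries its Borel σ-algebra. -/
instance : MeasurableSpace RetainedLoss := borel RetainedLoss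

instance : BorelSpace RetainedLoss := ⟨rfl⟩

end RetainedLoss

/-! ### The dynamic reinsurance model -/

/-- The data of the dynamic reinsurance model. The index `n` refers to the period `[n, n+1)`:
`claim n` is the aggregate claim `Y_{n+1}` and `income n` is the premium income `Z_{n+1}`, both
realized at time `n + 1`; `premium n` is the reinsurer's premium principle and `risk n` the
insurer's risk measure at time `n`. `budgetConstrained` selects one of the two cases
(budget-constrained or unconstrained) of the model. -/
structure ReinsuranceModel (Ω : Type*) where
  claim : ℕ → Ω → ℝ≥0
  income : ℕ → Ω → ℝ≥0
  premium : ℕ → (Ω → ℝ≥0) → EReal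
  risk : ℕ → (Ω → ℝ) → EReal
  discount : ℝ
  budgetConstrained : Prop

namespace ReinsuranceModel

variable {Ω : Type*} (M : ReinsuranceModel Ω)

/-- Standing assumptions of the model: `Y_{n+1} ∈ L^p_+`, `Z_{n+1} ∈ L^∞_+`, the pairs
`(Y_{n+1}, Z_{n+1})` are independent, the premium principles are law-invariant, monotone and
normalized with the Fatou property and `π_{R,n}(Y_{n+1}) < ∞`, and the discount factor is
in `(0, 1]`. -/
structure Standing [MeasurableSpace Ω] (p : ℝ≥0∞) (P : Measure Ω) : Prop where
  claim_mem : ∀ n, IsLpPosRV p P (M.claim n)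
  income_mem : ∀ n, IsLpPosRV ∞ P (M.income n)
  indep : iIndepFun (fun n ω => (M.claim n ω, M.income n ω)) P
  premium_principle : ∀ n, IsFatouPremiumPrinciple p P (M.premium n)
  premium_claim_lt_top : ∀ n, M.premium n (M.claim n) < ⊤
  discount_pos : 0 < M.discount
  discount_le_one : M.discount ≤ 1

/-- Assumptions on the risk measures `ρ_0, …, ρ_{N-1}` for the planning horizon `N`. -/
structure FiniteHorizonAssumption [MeasurableSpace Ω] (p : ℝ≥0∞) (P : Measure Ω) (N : ℕ) :
    Prop where
  risk_measure : ∀ n < N, IsFatouMonetaryRiskMeasure p P (M.risk n)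
  risk_claim_lt_top : ∀ n < N, ∀ l : ℝ≥0, M.risk n (fun ω => (l : ℝ) * (M.claim n ω : ℝ)) < ⊤

/-- The reinsurance premium `π_{R,n}(f) = π_{R,n}(Y_{n+1} - f(Y_{n+1}))`. -/
def reinsurancePremium (n : ℕ) (f : RetainedLoss) : EReal :=
  M.premium n (fun ω => M.claim n ω - f (M.claim n ω))

/-- The set `D_n(x)` of admissible retained loss functions: all of `𝓕` in the unconstrained case,
`{f | π_{R,n}(f) ≤ x⁺}` in the budget-constrained case. -/
def admissible (n : ℕ) (x : ℝ) : Set RetainedLoss :=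
  {f | M.budgetConstrained → M.reinsurancePremium n f ≤ ((max x 0 : ℝ) : EReal)}

/-- The feasible histories `h_n = (x_0, f_0, x_1, …, f_{n-1}, x_n)`, `f_k ∈ D_k(x_k)`: the states
`x_0, …, x_n` are the first component and the actions `f_0, …, f_{n-1}` the second. The σ-algebra
is the one induced by the product of the Borel σ-algebras. -/
abbrev Hist (n : ℕ) : Type :=
  {h : (Fin (n + 1) → ℝ) × (Fin n → RetainedLoss) //
    ∀ k : Fin n, h.2 k ∈ M.admissible k (h.1 k.castSucc)}

variable {M}

/-- The current state `x_n` of a history `h_n`. -/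
def Hist.current {n : ℕ} (h : M.Hist n) : ℝ := h.1.1 (Fin.last n)

/-- The history `(h_n, f, x')` at time `n + 1`. -/
def Hist.extend {n : ℕ} (h : M.Hist n) (f : RetainedLoss) (hf : f ∈ M.admissible n h.current)
    (x' : ℝ) : M.Hist (n + 1) :=
  ⟨(Fin.snoc (α := fun _ => ℝ) h.1.1 x', Fin.snoc (α := fun _ => RetainedLoss) h.1.2 f), by
    intro k
    refine Fin.lastCases ?_ (fun j => ?_) k
    · simpa [Fin.snoc_castSucc, Hist.current] using hf
    · simpa [Fin.snoc_castSucc] using h.2 j⟩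

variable (M)

/-- A decision rule at time `n`: a measurable map `d_n` from the feasible histories to `𝓕` with
`d_n(h_n) ∈ D_n(x_n)`. -/
structure DecisionRule (n : ℕ) where
  act : M.Hist n → RetainedLoss
  measurable_act : Measurable act
  feasible : ∀ h, act h ∈ M.admissible n h.current

/-- An `N`-stage policy `(d_0, …, d_{N-1})`. -/
abbrev Policy (N : ℕ) : Type := ∀ n : Fin N, M.DecisionRule n

/-- A Markov decision rule at time `n`, as a measurable function of the current state only. -/
structure MarkovRule (n : ℕ) where
  act : ℝ → RetainedLoss
  measurable_act : Measurable act
  feasible : ∀ x, act x ∈ M.admissible n x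

/-- An `N`-stage Markov policy. -/
abbrev MarkovPolicy (N : ℕ) : Type := ∀ n : Fin N, M.MarkovRule n

variable {M}

theorem Hist.measurable_current {n : ℕ} : Measurable (Hist.current : M.Hist n → ℝ) :=
  (measurable_pi_apply (Fin.last n)).comp (measurable_fst.comp measurable_subtype_coe)

/-- A Markov decision rule as a decision rule, `h_n ↦ d_n(x_n)`. -/
def MarkovRule.toDecisionRule {n : ℕ} (d : M.MarkovRule n) : M.DecisionRule n where
  act h := d.act h.current
  measurable_act := d.measurable_act.comp Hist.measurable_current
  feasible h := d.feasible h.current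

/-- A Markov policy as a policy. -/
def MarkovPolicy.toPolicy {N : ℕ} (pol : M.MarkovPolicy N) : M.Policy N :=
  fun n => (pol n).toDecisionRule

variable (M)

/-- The effective risk of period `[n, n+1)` in state `x` under the action `f`, with future cost of
capital `v` as a function of the next state:
`f(Y) + π_{R,n}(f) - Z - x + β v(x + Z - f(Y) - π_{R,n}(f))`, where `Y = Y_{n+1}`, `Z = Z_{n+1}`.
Under the standing assumptions `π_{R,n}(f)` is finite. -/
def effectiveRisk (n : ℕ) (v : ℝ → EReal) (x : ℝ) (f : RetainedLoss) (ω : Ω) : ℝ :=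
  (f (M.claim n ω) : ℝ) + (M.reinsurancePremium n f).toReal - (M.income n ω : ℝ) - x
    + M.discount * (v (x + (M.income n ω : ℝ) - (f (M.claim n ω) : ℝ)
        - (M.reinsurancePremium n f).toReal)).toReal

/-- `L_n v (x, f)`. -/
def opL (n : ℕ) (v : ℝ → EReal) (x : ℝ) (f : RetainedLoss) : EReal :=
  M.risk n (M.effectiveRisk n v x f)

/-- `𝒯_{n,d} v (x) = L_n v (x, d(x))` for a Markov decision rule `d`. -/
def opTd (n : ℕ) (d : M.MarkovRule n) (v : ℝ → EReal) (x : ℝ) : EReal :=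
  M.opL n v x (d.act x)

/-- `𝒯_n v (x) = inf_{f ∈ D_n(x)} L_n v (x, f)`. -/
def opT (n : ℕ) (v : ℝ → EReal) (x : ℝ) : EReal :=
  ⨅ f ∈ M.admissible n x, M.opL n v x f

/-- The value `V_{nπ}(h_n)` of a policy `π` for the planning horizon `N`: `V_{Nπ} = 0`, and
`V_{nπ}(h_n)` is the risk measure `ρ_n` of the effective risk with future cost of capital
`x' ↦ V_{n+1,π}(h_n, d_n(h_n), x')`. -/
def policyValue {N : ℕ} (pol : M.Policy N) (n : ℕ) (h : M.Hist n) : EReal :=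
  if hn : n < N then
    M.opL n
      (fun x' => policyValue pol (n + 1)
        (h.extend ((pol ⟨n, hn⟩).act h) ((pol ⟨n, hn⟩).feasible h) x'))
      h.current ((pol ⟨n, hn⟩).act h)
  else 0
termination_by N - n

/-- The value function `V_n(h_n) = inf_{π ∈ Π} V_{nπ}(h_n)`. -/
def valueFn (N n : ℕ) (h : M.Hist n) : EReal := ⨅ pol : M.Policy N, M.policyValue pol n h

/-- The value `J_{nπ}(x)` of a Markov policy: `J_{Nπ} = 0`, `J_{nπ} = 𝒯_{n,d_n} J_{n+1,π}`. -/
def markovPolicyValue {N : ℕ} (pol : M.MarkovPolicy N) (n : ℕ) (x : ℝ) : EReal :=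
  if hn : n < N then
    M.opTd n (pol ⟨n, hn⟩) (fun x' => markovPolicyValue pol (n + 1) x') x
  else 0
termination_by N - n

/-- The Markov value function `J_n(x) = inf_{π ∈ Π^M} J_{nπ}(x)`. -/
def markovValueFn (N n : ℕ) (x : ℝ) : EReal :=
  ⨅ pol : M.MarkovPolicy N, M.markovPolicyValue pol n x

/-- The slopes `a_N = 0`, `a_n = 1 + β a_{n+1}` (so `a_{N-1} = 1`). -/
def slope (N n : ℕ) : ℝ :=
  if n < N then 1 + M.discount * slope N (n + 1) else 0
termination_by N - n

/-- The lower constants: `0` for `n = N`, and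
`c_n = (1 + β a_{n+1}) esssup(Z_{n+1}) + β c_{n+1}` for `n < N`. -/
def lowerConst [MeasurableSpace Ω] (P : Measure Ω) (N n : ℕ) : ℝ :=
  if n < N then
    (1 + M.discount * M.slope N (n + 1)) * ((essSup (M.income n) P : ℝ≥0) : ℝ)
      + M.discount * lowerConst P N (n + 1)
  else 0
termination_by N - n

/-- The upper constants: `0` for `n = N`, and
`c_n = ρ_n((1 + β a_{n+1}) Y_{n+1}) + (1 + β a_{n+1}) π_{R,n}(Y_{n+1}) + β c_{n+1}` for `n < N`.
Under the assumptions the values of `ρ_n` and `π_{R,n}` here are finite. -/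
def upperConst (N n : ℕ) : ℝ :=
  if n < N then
    (M.risk n (fun ω => (1 + M.discount * M.slope N (n + 1)) * (M.claim n ω : ℝ))).toReal
      + (1 + M.discount * M.slope N (n + 1)) * (M.premium n (M.claim n)).toReal
      + M.discount * upperConst N (n + 1)
  else 0
termination_by N - n

/-- The lower bounding function, `- c_n - a_n x⁺` with the lower constant `c_n`. -/
def lowerBd [MeasurableSpace Ω] (P : Measure Ω) (N n : ℕ) (x : ℝ) : ℝ :=
  -M.lowerConst P N n - M.slope N n * max x 0

/-- The upper bounding function, `c_n + a_n x⁻` with the upper constant `c_n`. -/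
def upperBd (N n : ℕ) (x : ℝ) : ℝ :=
  M.upperConst N n + M.slope N n * max (-x) 0

/-- The set `𝔹_n` of decreasing, lower semicontinuous functions between the bounding functions.
Since the bounds are real, its elements are real-valued. -/
def classB [MeasurableSpace Ω] (P : Measure Ω) (N n : ℕ) : Set (ℝ → EReal) :=
  {v | Antitone v ∧ LowerSemicontinuous v ∧
    ∀ x, (M.lowerBd P N n x : EReal) ≤ v x ∧ v x ≤ (M.upperBd N n x : EReal)}

end ReinsuranceModel

end

/-!
The theorem is backward induction with a verification argument; the analytic content is one step
of the Bellman recursion.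

**One step.** The effective risk is `g(S)` with `g(s) = -s + β v(s)`, where `S` is the surplus at
the end of the period. For `v ∈ 𝔹_{n+1}` the function `g` is decreasing and lower semicontinuous,
hence right-continuous. The bounds on `v` together with `0 ≤ f(Y) ≤ Y` and `0 ≤ π_R(f) ≤ π_R(Y)`
give an affine bound of `|g(S)|` by `Y + Z`, so that `g(S)` lies in `L^p`
(`isLpRV_effectiveRisk`), and monotonicity and translation invariance of the risk measure turn the
pointwise bounds into the bounds at time `n` (`lowerBd_le_opL`, `opL_le_upperBd`).

The map `(x, f) ↦ L_n v(x, f)` is lower semicontinuous (`lowerSemicontinuous_opL`). Here the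
premium `f ↦ π_R(f)` is only lower semicontinuous, so that along a convergent sequence the
surpluses `S_k` satisfy no more than `limsup S_k ≤ S`. But `max S S_k` converges to `S` from
above, hence `g(max S S_k) → g(S)` by right-continuity, the Fatou property applies to these
variables, and `g(max S S_k) ≤ g(S_k)`.

The space `𝓕` is compact by the Arzelà–Ascoli theorem, and the graph of the admissible sets is
closed. Hence `𝒯_n v` is lower semicontinuous and the infimum is attained
(`lowerSemicontinuous_iInf_section`, `exists_section_eq_iInf`). It is decreasing because `L_n v(·, f)` is decreasing and the
admissible sets grow with `x`; so `𝒯_n v ∈ 𝔹_n` (`opT_mem_classB`).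

**Measurable minimizers.** The set of minimizers at `x` hits a closed set `K` iff the infimum over
`K` does not exceed the infimum over all actions, a measurable condition on `x`. Countably many
evaluations separate the points of `𝓕`, and the lexicographically smallest minimizer with respect
to them is a measurable selection (`exists_measurable_selection`, `exists_measurable_argmin`).

**Verification.** Monotonicity of `L_n` in `v` and backward induction show that the solution of
the Bellman recursion is a lower bound for the value of every history-dependent policy
(`bellmanFn_le_policyValue`), attained by every sequence of Markov minimizers
(`markovPolicyValue_eq_bellmanFn`). So it is the value function of both problems.
-/

/-! ### Lower semicontinuity and measurable selection of minimizers -/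

theorem lowerSemicontinuous_of_le_liminf_seq {X : Type*} [TopologicalSpace X]
    [FirstCountableTopology X] {g : X → EReal}
    (h : ∀ (u : ℕ → X) (x : X), Tendsto u atTop (𝓝 x) → g x ≤ liminf (fun k => g (u k)) atTop) :
    LowerSemicontinuous g := by
  rw [lowerSemicontinuous_iff_isClosed_preimage]
  refine fun c => IsSeqClosed.isClosed fun u x hu hx => ?_
  refine (h u x hx).trans ((liminf_le_liminf (Eventually.of_forall hu)).trans ?_)
  rw [liminf_const]

/-- The minimizers of `φ` over the set `s`. -/
def argminSet {Y : Type*} (φ : Y → ℝ) (s : Set Y) : Set Y := {y ∈ s | ∀ z ∈ s, φ y ≤ φ z}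

theorem isClosed_argminSet {Y : Type*} [TopologicalSpace Y] {φ : Y → ℝ} (hφ : Continuous φ)
    {s : Set Y} (hs : IsClosed s) : IsClosed (argminSet φ s) := by
  have : argminSet φ s = s ∩ ⋂ z ∈ s, {y | φ y ≤ φ z} := by
    ext y; simp [argminSet]
  rw [this]
  exact hs.inter (isClosed_biInter fun z _ => isClosed_le hφ continuous_const)

theorem argminSet_nonempty {Y : Type*} [TopologicalSpace Y] [CompactSpace Y] {φ : Y → ℝ}
    (hφ : Continuous φ) {s : Set Y} (hs : IsClosed s) (hne : s.Nonempty) :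
    (argminSet φ s).Nonempty := by
  obtain ⟨y, hy, hmin⟩ := hs.isCompact.exists_isMinOn hne hφ.continuousOn
  exact ⟨y, hy, fun z hz => hmin hz⟩

/-- Passing to the minimizers of a continuous function preserves measurability of a closed-valued
map into a compact space. Comparing the two minima through rational levels expresses the hitting
sets of the minimizers by countably many hitting sets of `G`. -/
theorem measurableSet_argminSet_inter_nonempty {X Y : Type*} [MeasurableSpace X]
    [TopologicalSpace Y] [CompactSpace Y] {φ : Y → ℝ} (hφ : Continuous φ) {G : X → Set Y}
    (hc : ∀ x, IsClosed (G x))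
    (hm : ∀ K : Set Y, IsClosed K → MeasurableSet {x | (G x ∩ K).Nonempty})
    {K : Set Y} (hK : IsClosed K) : MeasurableSet {x | (argminSet φ (G x) ∩ K).Nonempty} := by
  have hlevel : ∀ q : ℚ, IsClosed {y | φ y ≤ q} := fun q => isClosed_le hφ continuous_const
  have : {x | (argminSet φ (G x) ∩ K).Nonempty} = {x | (G x ∩ K).Nonempty} ∩
      ⋂ q : ℚ, ({x | (G x ∩ {y | φ y ≤ q}).Nonempty}ᶜ ∪
        {x | (G x ∩ (K ∩ {y | φ y ≤ q})).Nonempty}) := by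
    ext x
    simp only [Set.mem_inter_iff, Set.mem_ofPred_eq, Set.mem_iInter, Set.mem_union,
      Set.mem_compl_iff]
    constructor
    · rintro ⟨y, ⟨hy, hmin⟩, hyK⟩
      refine ⟨⟨y, hy, hyK⟩, fun q => ?_⟩
      by_cases h : (G x ∩ {y | φ y ≤ q}).Nonempty
      · obtain ⟨z, hz, hzq⟩ := h
        exact Or.inr ⟨y, hy, hyK, (hmin z hz).trans hzq⟩
      · exact Or.inl h
    · rintro ⟨hne, hq⟩
      obtain ⟨y, hy, hmin⟩ :=
        ((hc x).inter hK).isCompact.exists_isMinOn hne hφ.continuousOn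
      refine ⟨y, ⟨hy.1, fun z hz => ?_⟩, hy.2⟩
      by_contra! hlt
      obtain ⟨q, hzq, hqy⟩ := exists_rat_btwn hlt
      rcases hq q with h | ⟨w, hw, hwK, hwq⟩
      · exact h ⟨z, hz, hzq.le⟩
      · have h1 : φ y ≤ φ w := hmin ⟨hw, hwK⟩
        exact absurd (h1.trans hwq) (not_le.mpr hqy)
  rw [this]
  exact (hm K hK).inter (MeasurableSet.iInter fun q =>
    (hm _ (hlevel q)).compl.union (hm _ (hK.inter (hlevel q))))

/-- Successive minimization of `φ 0, …, φ (n - 1)` over the set `s`. -/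
def lexArgmin {Y : Type*} (φ : ℕ → Y → ℝ) (s : Set Y) : ℕ → Set Y
  | 0 => s
  | n + 1 => argminSet (φ n) (lexArgmin φ s n)

/-- A measurable closed-valued map into a compact space has a measurable selection, if countably
many continuous functions separate the points: the lexicographic minimizer with respect to these
functions. -/
theorem exists_measurable_selection {X Y : Type*} [MeasurableSpace X]
    [TopologicalSpace Y] [CompactSpace Y] [MeasurableSpace Y] [BorelSpace Y]
    {φ : ℕ → Y → ℝ} (hφ : ∀ i, Continuous (φ i))
    (hsep : ∀ y z, (∀ i, φ i y = φ i z) → y = z) {G : X → Set Y}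
    (hc : ∀ x, IsClosed (G x)) (hne : ∀ x, (G x).Nonempty)
    (hm : ∀ K : Set Y, IsClosed K → MeasurableSet {x | (G x ∩ K).Nonempty}) :
    ∃ d : X → Y, Measurable d ∧ ∀ x, d x ∈ G x := by
  have hcl : ∀ n x, IsClosed (lexArgmin φ (G x) n) := by
    intro n
    induction n with
    | zero => exact hc
    | succ n ih => exact fun x => isClosed_argminSet (hφ n) (ih x)
  have hnonempty : ∀ n x, (lexArgmin φ (G x) n).Nonempty := by
    intro n
    induction n with
    | zero => exact hne
    | succ n ih => exact fun x => argminSet_nonempty (hφ n) (hcl n x) (ih x)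
  have hmeas : ∀ n (K : Set Y), IsClosed K →
      MeasurableSet {x | (lexArgmin φ (G x) n ∩ K).Nonempty} := by
    intro n
    induction n with
    | zero => exact hm
    | succ n ih =>
      exact fun K hK => measurableSet_argminSet_inter_nonempty (hφ n) (hcl n) ih hK
  have hanti : ∀ n x, lexArgmin φ (G x) (n + 1) ⊆ lexArgmin φ (G x) n := fun n x y hy => hy.1
  have hinter : ∀ x, (⋂ n, lexArgmin φ (G x) n).Nonempty := fun x =>
    IsCompact.nonempty_iInter_of_sequence_nonempty_isCompact_isClosed _ (fun n => hanti n x)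
      (fun n => hnonempty n x) (hcl 0 x).isCompact (fun n => hcl n x)
  choose d hd using hinter
  have hd' : ∀ x n, d x ∈ lexArgmin φ (G x) n := fun x => Set.mem_iInter.1 (hd x)
  have huniq : ∀ x y, (∀ n, y ∈ lexArgmin φ (G x) n) → y = d x := fun x y hy =>
    hsep _ _ fun i => le_antisymm ((hy (i + 1)).2 _ (hd' x i)) ((hd' x (i + 1)).2 _ (hy i))
  refine ⟨d, measurable_of_isClosed fun K hK => ?_, fun x => hd' x 0⟩
  have : d ⁻¹' K = ⋂ n, {x | (lexArgmin φ (G x) n ∩ K).Nonempty} := by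
    ext x
    simp only [Set.mem_preimage, Set.mem_iInter, Set.mem_ofPred_eq]
    refine ⟨fun h n => ⟨d x, hd' x n, h⟩, fun h => ?_⟩
    obtain ⟨y, hy⟩ :=
      IsCompact.nonempty_iInter_of_sequence_nonempty_isCompact_isClosed
        (fun n => lexArgmin φ (G x) n ∩ K)
        (fun n => Set.inter_subset_inter_left _ (hanti n x)) h
        ((hcl 0 x).inter hK).isCompact (fun n => (hcl n x).inter hK)
    rw [Set.mem_iInter] at hy
    rw [← huniq x y fun n => (hy n).1]
    exact (hy 0).2
  rw [this]
  exact MeasurableSet.iInter fun n => hmeas n K hK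

theorem exists_section_eq_iInf {X Y : Type*} [TopologicalSpace X] [TopologicalSpace Y]
    [CompactSpace Y] {S : Set (X × Y)} (hS : IsClosed S) {L : X → Y → EReal}
    (hL : LowerSemicontinuous (Function.uncurry L)) {x : X}
    (hx : ⨅ y ∈ {y | (x, y) ∈ S}, L x y < ⊤) :
    ∃ y, (x, y) ∈ S ∧ L x y = ⨅ y ∈ {y | (x, y) ∈ S}, L x y := by
  have hne : {y | (x, y) ∈ S}.Nonempty := by
    by_contra h
    rw [Set.not_nonempty_iff_eq_empty] at h
    simp [h] at hx
  have hcont : Continuous fun y : Y => (x, y) := by fun_prop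
  have hcomp : IsCompact {y | (x, y) ∈ S} := (hS.preimage hcont).isCompact
  have hl : LowerSemicontinuous fun y => L x y := hL.comp hcont
  obtain ⟨y, hy, hmin⟩ := LowerSemicontinuousOn.exists_isMinOn hne hcomp
    (hl.lowerSemicontinuousOn _)
  exact ⟨y, hy, le_antisymm (le_iInf₂ fun z hz => hmin hz) (iInf₂_le y hy)⟩

/-- The value of a parametric minimization problem over a compact space, with closed constraint
graph and lower semicontinuous objective, is lower semicontinuous. -/
theorem lowerSemicontinuous_iInf_section {X Y : Type*} [TopologicalSpace X] [TopologicalSpace Y]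
    [CompactSpace Y] {S : Set (X × Y)} (hS : IsClosed S) {L : X → Y → EReal}
    (hL : LowerSemicontinuous (Function.uncurry L)) :
    LowerSemicontinuous fun x => ⨅ y ∈ {y | (x, y) ∈ S}, L x y := by
  rw [lowerSemicontinuous_iff_isClosed_preimage]
  intro c
  rcases eq_or_ne c ⊤ with rfl | hc
  · simp
  have : (fun x => ⨅ y ∈ {y | (x, y) ∈ S}, L x y) ⁻¹' Set.Iic c =
      Prod.fst '' (S ∩ Function.uncurry L ⁻¹' Set.Iic c) := by
    ext x
    simp only [Set.mem_preimage, Set.mem_Iic, Set.mem_image]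
    constructor
    · intro h
      obtain ⟨y, hy, hmin⟩ := exists_section_eq_iInf hS hL (h.trans_lt hc.lt_top)
      exact ⟨(x, y), ⟨hy, hmin.trans_le h⟩, rfl⟩
    · rintro ⟨⟨x', y⟩, ⟨hy, hle⟩, rfl⟩
      exact (iInf₂_le y hy).trans hle
  rw [this]
  exact isClosedMap_fst_of_compactSpace _ (hS.inter (hL.isClosed_preimage c))

/-- Measurable minimizers of a parametric minimization problem over a compact space. -/
theorem exists_measurable_argmin {X Y : Type*} [TopologicalSpace X] [MeasurableSpace X]
    [OpensMeasurableSpace X] [TopologicalSpace Y] [CompactSpace Y] [MeasurableSpace Y]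
    [BorelSpace Y] {φ : ℕ → Y → ℝ} (hφ : ∀ i, Continuous (φ i))
    (hsep : ∀ y z, (∀ i, φ i y = φ i z) → y = z) {S : Set (X × Y)} (hS : IsClosed S)
    {L : X → Y → EReal} (hL : LowerSemicontinuous (Function.uncurry L))
    (hfin : ∀ x, ⨅ y ∈ {y | (x, y) ∈ S}, L x y < ⊤) :
    ∃ d : X → Y, Measurable d ∧
      ∀ x, (x, d x) ∈ S ∧ L x (d x) = ⨅ y ∈ {y | (x, y) ∈ S}, L x y := by
  have hval := lowerSemicontinuous_iInf_section hS hL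
  refine exists_measurable_selection hφ hsep
    (G := fun x => {y | (x, y) ∈ S ∧ L x y = ⨅ y ∈ {y | (x, y) ∈ S}, L x y})
    (fun x => ?_) (fun x => exists_section_eq_iInf hS hL (hfin x)) (fun K hK => ?_)
  · have hcont : Continuous fun y : Y => (x, y) := by fun_prop
    have : {y | (x, y) ∈ S ∧ L x y = ⨅ y ∈ {y | (x, y) ∈ S}, L x y} =
        (fun y => (x, y)) ⁻¹' (S ∩ Function.uncurry L ⁻¹'
          Set.Iic (⨅ y ∈ {y | (x, y) ∈ S}, L x y)) := by
      ext y
      exact and_congr_right fun hy => ⟨fun h => h.le, fun h => le_antisymm h (iInf₂_le y hy)⟩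
    rw [this]
    exact (hS.inter (hL.isClosed_preimage _)).preimage hcont
  · have hSK : IsClosed (S ∩ Prod.snd ⁻¹' K) := hS.inter (hK.preimage continuous_snd)
    have hvalK := lowerSemicontinuous_iInf_section hSK hL
    -- Some minimizer lies in `K` iff the constraint to `K` does not increase the value.
    have : {x | ({y | (x, y) ∈ S ∧ L x y = ⨅ y ∈ {y | (x, y) ∈ S}, L x y} ∩ K).Nonempty} =
        {x | ⨅ y ∈ {y | (x, y) ∈ S ∩ Prod.snd ⁻¹' K}, L x y ≤
          ⨅ y ∈ {y | (x, y) ∈ S}, L x y} := by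
      ext x
      constructor
      · rintro ⟨y, ⟨hy, hmin⟩, hyK⟩
        exact (iInf₂_le (f := fun y (_ : y ∈ {y | (x, y) ∈ S ∩ Prod.snd ⁻¹' K}) => L x y) y
          ⟨hy, hyK⟩).trans hmin.le
      · intro h
        obtain ⟨y, hy, hmin⟩ := exists_section_eq_iInf hSK hL (lt_of_le_of_lt h (hfin x))
        exact ⟨y, ⟨hy.1, le_antisymm (hmin.trans_le h) (iInf₂_le y hy.1)⟩, hy.2⟩
    rw [this]
    exact measurableSet_le hvalK.measurable hval.measurable

/-! ### The space of retained loss functions -/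

namespace RetainedLoss

theorem le_self (f : RetainedLoss) (t : ℝ≥0) : f t ≤ t := f.2.1 t

theorem isInducing_toContinuousMap : IsInducing toContinuousMap := ⟨rfl⟩

theorem continuous_eval (t : ℝ≥0) : Continuous fun f : RetainedLoss => f t := by
  rw [NNReal.isEmbedding_coe.isInducing.continuous_iff]
  exact (continuous_eval_const t).comp isInducing_toContinuousMap.continuous

instance : FirstCountableTopology RetainedLoss :=
  isInducing_toContinuousMap.firstCountableTopology

/-- The real-valued functions that come from `𝓕`, described by conditions that are closed under
pointwise convergence. -/
theorem range_toFun :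
    ContinuousMap.toFun '' Set.range toContinuousMap =
      {g : ℝ≥0 → ℝ | (∀ t : ℝ≥0, g t ∈ Set.Icc 0 (t : ℝ)) ∧
        ∀ s t : ℝ≥0, s ≤ t → g s ≤ g t ∧ (s : ℝ) - g s ≤ t - g t} := by
  ext g
  constructor
  · rintro ⟨_, ⟨f, rfl⟩, rfl⟩
    refine ⟨fun t => ⟨NNReal.coe_nonneg _, by exact_mod_cast f.le_self t⟩,
      fun s t hst => ⟨by exact_mod_cast f.2.2.1 hst, ?_⟩⟩
    have h3 : ((s - f s : ℝ≥0) : ℝ) ≤ ((t - f t : ℝ≥0) : ℝ) := by exact_mod_cast f.2.2.2 hst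
    rwa [NNReal.coe_sub (f.le_self s), NNReal.coe_sub (f.le_self t)] at h3
  · rintro ⟨h1, h2⟩
    have hle : ∀ t, (⟨g t, (h1 t).1⟩ : ℝ≥0) ≤ t := fun t => (h1 t).2
    let f : RetainedLoss := ⟨fun t => ⟨g t, (h1 t).1⟩, hle, fun s t hst => (h2 s t hst).1, by
      intro s t hst
      rw [← NNReal.coe_le_coe]
      simp only [NNReal.coe_sub (hle _)]
      exact (h2 s t hst).2⟩
    exact ⟨f.toContinuousMap, ⟨f, rfl⟩, rfl⟩

/-- Retained loss functions are `1`-Lipschitz with `0 ≤ f t ≤ t`, hence compactness of `𝓕` is an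
instance of the Arzelà–Ascoli theorem. -/
instance : CompactSpace RetainedLoss := by
  rw [← isCompact_univ_iff, isInducing_toContinuousMap.isCompact_iff, Set.image_univ]
  refine ArzelaAscoli.isCompact_of_equicontinuous _ ?_ ?_
  · rw [range_toFun]
    refine (isCompact_univ_pi fun t : ℝ≥0 =>
      isCompact_Icc (a := (0 : ℝ)) (b := t)).of_isClosed_subset ?_ fun g hg t _ => hg.1 t
    simp only [Set.ofPred_and, Set.ofPred_forall]
    refine (isClosed_iInter fun t => isClosed_Icc.preimage (continuous_apply t)).inter
      (isClosed_iInter fun s => isClosed_iInter fun t => isClosed_iInter fun _ =>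
        (isClosed_le (continuous_apply s) (continuous_apply t)).inter
          (isClosed_le (continuous_const.sub (continuous_apply s))
            (continuous_const.sub (continuous_apply t))))
  · refine (LipschitzWith.uniformEquicontinuous (K := 1) _ ?_).equicontinuous
    rintro ⟨_, f, rfl⟩
    exact LipschitzWith.of_dist_le_mul fun s t => f.lipschitz.dist_le_mul s t

/-- Evaluations at a dense sequence separate the points of `𝓕`. -/
theorem ext_denseSeq {f g : RetainedLoss}
    (h : ∀ i, (f (TopologicalSpace.denseSeq ℝ≥0 i) : ℝ) = g (TopologicalSpace.denseSeq ℝ≥0 i)) :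
    f = g := by
  refine Subtype.ext (f.lipschitz.continuous.ext_on
    (TopologicalSpace.denseRange_denseSeq ℝ≥0) g.lipschitz.continuous ?_)
  rintro _ ⟨i, rfl⟩
  exact NNReal.coe_injective (h i)

/-- Full retention, `f(t) = t`. -/
def full : RetainedLoss := ⟨id, fun _ => le_rfl, monotone_id, by
  intro s t _; simp⟩

theorem full_apply (t : ℝ≥0) : full t = t := rfl

end RetainedLoss

namespace ReinsuranceModel

variable {Ω : Type*}

/-! ### Surplus and stage costs -/

theorem admissible_mono (M : ReinsuranceModel Ω) (n : ℕ) {x y : ℝ} (hxy : x ≤ y) :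
    M.admissible n x ⊆ M.admissible n y := fun _ hf hB =>
  (hf hB).trans (by exact_mod_cast max_le_max_right 0 hxy)

/-- The surplus `x + Z - f(Y) - π_R(f)` at the end of the period. -/
def nextSurplus (M : ReinsuranceModel Ω) (n : ℕ) (x : ℝ) (f : RetainedLoss) (ω : Ω) : ℝ :=
  x + (M.income n ω : ℝ) - (f (M.claim n ω) : ℝ) - (M.reinsurancePremium n f).toReal

/-- The effective risk as a function `s ↦ -s + β v(s)` of the surplus at the end of the period. -/
def stageCost (M : ReinsuranceModel Ω) (v : ℝ → EReal) (s : ℝ) : ℝ :=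
  -s + M.discount * (v s).toReal

theorem effectiveRisk_eq_stageCost (M : ReinsuranceModel Ω) (n : ℕ) (v : ℝ → EReal) (x : ℝ)
    (f : RetainedLoss) :
    M.effectiveRisk n v x f = fun ω => M.stageCost v (M.nextSurplus n x f ω) := by
  funext ω
  simp only [effectiveRisk, stageCost, nextSurplus]
  ring

theorem measurable_stageCost (M : ReinsuranceModel Ω) {v : ℝ → EReal} (hv : Measurable v) :
    Measurable (M.stageCost v) :=
  measurable_id.neg.add (hv.ereal_toReal.const_mul _)

theorem slope_eq (M : ReinsuranceModel Ω) {N n : ℕ} (hn : n < N) :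
    M.slope N n = 1 + M.discount * M.slope N (n + 1) := by
  rw [slope, if_pos hn]

variable [MeasurableSpace Ω] {P : Measure Ω} {p : ℝ≥0∞} {M : ReinsuranceModel Ω}

/-! ### Reinsurance premiums and admissible actions -/

theorem Standing.measurable_claim (hM : M.Standing p P) (n : ℕ) : Measurable (M.claim n) :=
  (hM.claim_mem n).1

theorem Standing.measurable_retained (hM : M.Standing p P) (n : ℕ) (f : RetainedLoss) :
    Measurable fun ω => f (M.claim n ω) :=
  f.lipschitz.continuous.measurable.comp (hM.measurable_claim n)

theorem Standing.isLpPosRV_ceded (hM : M.Standing p P) (n : ℕ) (f : RetainedLoss) :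
    IsLpPosRV p P fun ω => M.claim n ω - f (M.claim n ω) := by
  have hmeas : Measurable fun ω => M.claim n ω - f (M.claim n ω) :=
    (hM.measurable_claim n).sub (hM.measurable_retained n f)
  refine ⟨hmeas, (hM.claim_mem n).2.mono hmeas.coe_nnreal_real.aestronglyMeasurable ?_⟩
  refine Eventually.of_forall fun ω => ?_
  rw [Real.norm_of_nonneg (NNReal.coe_nonneg _), Real.norm_of_nonneg (NNReal.coe_nonneg _)]
  exact_mod_cast tsub_le_self

theorem Standing.reinsurancePremium_nonneg (hM : M.Standing p P) (n : ℕ) (f : RetainedLoss) :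
    0 ≤ M.reinsurancePremium n f := by
  rw [← (hM.premium_principle n).normalized]
  refine (hM.premium_principle n).monotone _ _ ⟨measurable_const, MemLp.zero'⟩
    (hM.isLpPosRV_ceded n f) (Eventually.of_forall fun ω => zero_le)

theorem Standing.reinsurancePremium_le (hM : M.Standing p P) (n : ℕ) (f : RetainedLoss) :
    M.reinsurancePremium n f ≤ M.premium n (M.claim n) :=
  (hM.premium_principle n).monotone _ _ (hM.isLpPosRV_ceded n f) (hM.claim_mem n)
    (Eventually.of_forall fun _ => tsub_le_self)

theorem Standing.coe_toReal_reinsurancePremium (hM : M.Standing p P) (n : ℕ) (f : RetainedLoss) :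
    ((M.reinsurancePremium n f).toReal : EReal) = M.reinsurancePremium n f :=
  EReal.coe_toReal ((hM.reinsurancePremium_le n f).trans_lt (hM.premium_claim_lt_top n)).ne
    (ne_bot_of_le_ne_bot (by simp) (hM.reinsurancePremium_nonneg n f))

theorem Standing.toReal_reinsurancePremium_nonneg (hM : M.Standing p P) (n : ℕ)
    (f : RetainedLoss) : 0 ≤ (M.reinsurancePremium n f).toReal :=
  EReal.toReal_nonneg (hM.reinsurancePremium_nonneg n f)

theorem Standing.toReal_reinsurancePremium_le (hM : M.Standing p P) (n : ℕ)
    (f : RetainedLoss) :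
    (M.reinsurancePremium n f).toReal ≤ (M.premium n (M.claim n)).toReal :=
  EReal.toReal_le_toReal (hM.reinsurancePremium_le n f)
    (ne_bot_of_le_ne_bot (by simp) (hM.reinsurancePremium_nonneg n f))
    (hM.premium_claim_lt_top n).ne

/-- The Fatou property makes the reinsurance premium lower semicontinuous on `𝓕`; it need not be
continuous. -/
theorem Standing.reinsurancePremium_le_liminf (hM : M.Standing p P) (n : ℕ)
    {u : ℕ → RetainedLoss} {f : RetainedLoss} (hu : Tendsto u atTop (𝓝 f)) :
    M.reinsurancePremium n f ≤ liminf (fun k => M.reinsurancePremium n (u k)) atTop := by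
  refine (hM.premium_principle n).fatou _ _ (M.claim n) (fun k => hM.isLpPosRV_ceded n (u k))
    (hM.isLpPosRV_ceded n f) (hM.claim_mem n)
    (fun k => Eventually.of_forall fun _ => tsub_le_self) (Eventually.of_forall fun ω => ?_)
  exact tendsto_const_nhds.sub (((RetainedLoss.continuous_eval _).tendsto f).comp hu)

theorem Standing.isClosed_admissible (hM : M.Standing p P) (n : ℕ) :
    IsClosed {q : ℝ × RetainedLoss | q.2 ∈ M.admissible n q.1} := by
  refine IsSeqClosed.isClosed fun u q hu hq hB => ?_
  have h1 : M.reinsurancePremium n q.2 ≤ liminf (fun k => M.reinsurancePremium n (u k).2) atTop :=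
    hM.reinsurancePremium_le_liminf n ((continuous_snd.tendsto q).comp hq)
  have h2 : Tendsto (fun k => ((max (u k).1 0 : ℝ) : EReal)) atTop (𝓝 ((max q.1 0 : ℝ) : EReal)) :=
    ((continuous_coe_real_ereal.comp (continuous_fst.max continuous_const)).tendsto q).comp hq
  rw [← h2.liminf_eq]
  exact h1.trans (liminf_le_liminf (Eventually.of_forall fun k => hu k hB))

/-- Ceding nothing costs nothing, so full retention is always affordable. -/
theorem Standing.full_mem_admissible (hM : M.Standing p P) (n : ℕ) (x : ℝ) :
    RetainedLoss.full ∈ M.admissible n x := by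
  intro _
  have : M.reinsurancePremium n RetainedLoss.full = 0 := by
    simp only [reinsurancePremium, RetainedLoss.full_apply, tsub_self]
    exact (hM.premium_principle n).normalized
  rw [this]
  exact_mod_cast le_max_right _ _

/-! ### Bounds on stage costs -/

/-- `v` lies between the two bounding functions at time `n`. -/
def WithinBounds (M : ReinsuranceModel Ω) (P : Measure Ω) (N n : ℕ) (v : ℝ → EReal) : Prop :=
  ∀ x, (M.lowerBd P N n x : EReal) ≤ v x ∧ v x ≤ (M.upperBd N n x : EReal)

section WithinBounds

variable {N n : ℕ} {v : ℝ → EReal}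

theorem WithinBounds.ne_top (hv : M.WithinBounds P N n v) (x : ℝ) : v x ≠ ⊤ :=
  ne_top_of_le_ne_top (EReal.coe_ne_top _) (hv x).2

theorem WithinBounds.ne_bot (hv : M.WithinBounds P N n v) (x : ℝ) : v x ≠ ⊥ :=
  ne_bot_of_le_ne_bot (EReal.coe_ne_bot _) (hv x).1

theorem WithinBounds.lowerBd_le_toReal (hv : M.WithinBounds P N n v) (x : ℝ) :
    M.lowerBd P N n x ≤ (v x).toReal := by
  have := (hv x).1
  rwa [← EReal.coe_toReal (hv.ne_top x) (hv.ne_bot x), EReal.coe_le_coe_iff] at this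

theorem WithinBounds.toReal_le_upperBd (hv : M.WithinBounds P N n v) (x : ℝ) :
    (v x).toReal ≤ M.upperBd N n x := by
  have := (hv x).2
  rwa [← EReal.coe_toReal (hv.ne_top x) (hv.ne_bot x), EReal.coe_le_coe_iff] at this

end WithinBounds

theorem slope_nonneg (hM : M.Standing p P) (N n : ℕ) : 0 ≤ M.slope N n := by
  have h0 := hM.discount_pos
  induction hk : N - n generalizing n with
  | zero => rw [slope, if_neg (by omega)]
  | succ k ih =>
    rw [slope_eq M (by omega : n < N)]
    have := ih (n + 1) (by omega)
    positivity

theorem stageCost_le (hM : M.Standing p P) {N n : ℕ} (hn : n < N) {v : ℝ → EReal}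
    (hv : M.WithinBounds P N (n + 1) v) (s : ℝ) :
    M.stageCost v s ≤ M.slope N n * max (-s) 0 + M.discount * M.upperConst N (n + 1) := by
  have h := mul_le_mul_of_nonneg_left (hv.toReal_le_upperBd s) hM.discount_pos.le
  have h1 := le_max_left (-s) 0
  rw [slope_eq M hn, stageCost]
  simp only [upperBd] at h
  linarith

theorem le_stageCost (hM : M.Standing p P) {N n : ℕ} (hn : n < N) {v : ℝ → EReal}
    (hv : M.WithinBounds P N (n + 1) v) (s : ℝ) :
    -(M.slope N n * max s 0) - M.discount * M.lowerConst P N (n + 1) ≤ M.stageCost v s := by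
  have h := mul_le_mul_of_nonneg_left (hv.lowerBd_le_toReal s) hM.discount_pos.le
  have h1 := le_max_left s 0
  rw [slope_eq M hn, stageCost]
  simp only [lowerBd] at h
  linarith

theorem abs_stageCost_le (hM : M.Standing p P) {N n : ℕ} (hn : n < N) {v : ℝ → EReal}
    (hv : M.WithinBounds P N (n + 1) v) (s : ℝ) :
    |M.stageCost v s| ≤ M.discount * (|M.upperConst N (n + 1)| + |M.lowerConst P N (n + 1)|)
      + M.slope N n * |s| := by
  have hβ := hM.discount_pos.le
  have ha := slope_nonneg hM N n
  have h1 := stageCost_le hM hn hv s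
  have h2 := le_stageCost hM hn hv s
  have h3 := mul_le_mul_of_nonneg_left (max_le (neg_le_abs s) (abs_nonneg s)) ha
  have h4 := mul_le_mul_of_nonneg_left (max_le (le_abs_self s) (abs_nonneg s)) ha
  have h5 := mul_le_mul_of_nonneg_left (le_abs_self (M.upperConst N (n + 1))) hβ
  have h6 := mul_le_mul_of_nonneg_left (le_abs_self (M.lowerConst P N (n + 1))) hβ
  have h7 := mul_nonneg hβ (abs_nonneg (M.upperConst N (n + 1)))
  have h8 := mul_nonneg hβ (abs_nonneg (M.lowerConst P N (n + 1)))
  rw [abs_le]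
  constructor <;> linarith

theorem antitone_stageCost (hM : M.Standing p P) {N n : ℕ} {v : ℝ → EReal}
    (hv : M.WithinBounds P N n v) (hanti : Antitone v) : Antitone (M.stageCost v) := by
  intro s t hst
  have h := mul_le_mul_of_nonneg_left
    (EReal.toReal_le_toReal (hanti hst) (hv.ne_bot t) (hv.ne_top s)) hM.discount_pos.le
  simp only [stageCost]
  linarith

/-- A decreasing lower semicontinuous function is right-continuous. -/
theorem tendsto_stageCost {N n : ℕ} {v : ℝ → EReal} (hv : M.WithinBounds P N n v)
    (hanti : Antitone v) (hlsc : LowerSemicontinuous v) {s : ℝ} {t : ℕ → ℝ}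
    (hst : ∀ k, s ≤ t k) (ht : Tendsto t atTop (𝓝 s)) :
    Tendsto (fun k => M.stageCost v (t k)) atTop (𝓝 (M.stageCost v s)) := by
  have h : Tendsto (fun k => v (t k)) atTop (𝓝 (v s)) :=
    tendsto_order.2 ⟨fun a ha => ht.eventually (hlsc s a ha),
      fun a ha => Eventually.of_forall fun k => (hanti (hst k)).trans_lt ha⟩
  exact ht.neg.add (((EReal.tendsto_toReal (hv.ne_top s) (hv.ne_bot s)).comp h).const_mul _)

theorem Standing.measurable_nextSurplus (hM : M.Standing p P) (n : ℕ) (x : ℝ) (f : RetainedLoss) :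
    Measurable (M.nextSurplus n x f) :=
  (((hM.income_mem n).1.coe_nnreal_real.const_add x).sub
    (hM.measurable_retained n f).coe_nnreal_real).sub_const _

theorem Standing.neg_nextSurplus_le (hM : M.Standing p P) (n : ℕ) (x : ℝ) (f : RetainedLoss)
    (ω : Ω) :
    max (-M.nextSurplus n x f ω) 0 ≤
      (M.claim n ω : ℝ) + (M.premium n (M.claim n)).toReal + max (-x) 0 := by
  have h1 : (f (M.claim n ω) : ℝ) ≤ M.claim n ω := by exact_mod_cast f.le_self _
  have h2 := hM.toReal_reinsurancePremium_le n f
  have h3 := hM.toReal_reinsurancePremium_nonneg n f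
  have h4 := (M.income n ω).coe_nonneg
  have h5 := (M.claim n ω).coe_nonneg
  have h6 := le_max_left (-x) 0
  have h7 := le_max_right (-x) 0
  rw [nextSurplus]
  exact max_le (by linarith) (by linarith)

theorem Standing.nextSurplus_le (hM : M.Standing p P) (n : ℕ) (x : ℝ) (f : RetainedLoss)
    (ω : Ω) : max (M.nextSurplus n x f ω) 0 ≤ max x 0 + (M.income n ω : ℝ) := by
  have h3 := hM.toReal_reinsurancePremium_nonneg n f
  have h4 := (M.income n ω).coe_nonneg
  have h5 := (f (M.claim n ω)).coe_nonneg
  have h6 := le_max_left x 0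
  have h7 := le_max_right x 0
  rw [nextSurplus]
  exact max_le (by linarith) (by linarith)

theorem Standing.abs_nextSurplus_le (hM : M.Standing p P) (n : ℕ) (x : ℝ) (f : RetainedLoss)
    (ω : Ω) :
    |M.nextSurplus n x f ω| ≤
      |x| + (M.premium n (M.claim n)).toReal + ((M.claim n ω : ℝ) + (M.income n ω : ℝ)) := by
  have h1 := hM.neg_nextSurplus_le n x f ω
  have h2 := hM.nextSurplus_le n x f ω
  have h3 := (hM.toReal_reinsurancePremium_nonneg n f).trans (hM.toReal_reinsurancePremium_le n f)
  have h4 := (M.income n ω).coe_nonneg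
  have h5 := (M.claim n ω).coe_nonneg
  have h6 : max (-x) 0 ≤ |x| := max_le (neg_le_abs x) (abs_nonneg x)
  have h7 : max x 0 ≤ |x| := max_le (le_abs_self x) (abs_nonneg x)
  have h8 := le_max_left (-M.nextSurplus n x f ω) 0
  have h9 := le_max_left (M.nextSurplus n x f ω) 0
  rw [abs_le]
  constructor <;> linarith

theorem Standing.isLpRV_affine [IsProbabilityMeasure P] (hM : M.Standing p P) (n : ℕ) (A B : ℝ) :
    IsLpRV p P fun ω => A + B * ((M.claim n ω : ℝ) + (M.income n ω : ℝ)) := by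
  have hY := hM.claim_mem n
  have hZ := hM.income_mem n
  refine ⟨((hY.1.coe_nnreal_real.add hZ.1.coe_nnreal_real).const_mul B).const_add A, ?_⟩
  exact (memLp_const A).add ((hY.2.add (hZ.2.mono_exponent le_top)).const_mul B)

theorem Standing.isLpRV_of_abs_le [IsProbabilityMeasure P] (hM : M.Standing p P) (n : ℕ) {X : Ω → ℝ}
    (hX : Measurable X) {A B : ℝ}
    (h : ∀ ω, |X ω| ≤ A + B * ((M.claim n ω : ℝ) + (M.income n ω : ℝ))) : IsLpRV p P X :=
  ⟨hX, (hM.isLpRV_affine n A B).2.mono' hX.aestronglyMeasurable (Eventually.of_forall h)⟩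

theorem abs_stageCost_comp_le (hM : M.Standing p P) {N n : ℕ} (hn : n < N) {v : ℝ → EReal}
    (hv : M.WithinBounds P N (n + 1) v) {R s y : ℝ} (hs : |s| ≤ R + y) :
    |M.stageCost v s| ≤
      M.discount * (|M.upperConst N (n + 1)| + |M.lowerConst P N (n + 1)|) + M.slope N n * R
        + M.slope N n * y := by
  have h1 := abs_stageCost_le hM hn hv s
  have h2 := mul_le_mul_of_nonneg_left hs (slope_nonneg hM N n)
  linarith

theorem _root_.IsFatouMonetaryRiskMeasure.apply_const {ρ : (Ω → ℝ) → EReal}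
    (hρ : IsFatouMonetaryRiskMeasure p P ρ) (c : ℝ) : ρ (fun _ => c) = c := by
  have h := hρ.translation_invariant (fun _ => 0) c ⟨measurable_const, MemLp.zero'⟩
  simpa [hρ.normalized] using h

theorem Standing.income_le_essSup (hM : M.Standing p P) (n : ℕ) :
    ∀ᵐ ω ∂P, M.income n ω ≤ essSup (M.income n) P := by
  refine ae_le_essSup ?_
  obtain ⟨C, hC⟩ := eLpNormEssSup_lt_top_iff_isBoundedUnder.1
    (eLpNorm_exponent_top (f := fun ω => (M.income n ω : ℝ)) ▸ (hM.income_mem n).2.2)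
  refine ⟨C, ?_⟩
  simpa using hC

/-- The risk of a scaled claim is finite: it is nonnegative by monotonicity. -/
theorem coe_toReal_risk_claim (hM : M.Standing p P) {N n : ℕ} (hn : n < N)
    (hN : M.FiniteHorizonAssumption p P N) {l : ℝ} (hl : 0 ≤ l) :
    ((M.risk n fun ω => l * (M.claim n ω : ℝ)).toReal : EReal) =
      M.risk n fun ω => l * (M.claim n ω : ℝ) := by
  refine EReal.coe_toReal (hN.risk_claim_lt_top n hn ⟨l, hl⟩).ne
    (ne_bot_of_le_ne_bot (b := 0) (by simp) ?_)
  rw [← (hN.risk_measure n hn).normalized]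
  have hY := hM.claim_mem n
  refine (hN.risk_measure n hn).monotone _ _ ⟨measurable_const, MemLp.zero'⟩
    ⟨hY.1.coe_nnreal_real.const_mul l, hY.2.const_mul l⟩ (Eventually.of_forall fun ω => ?_)
  positivity

/-- Along a convergent sequence of states and actions, the upper limit of the surpluses is at most
the surplus at the limit; the surpluses themselves need not converge, since the premium is only
lower semicontinuous. Truncation from below at the surplus of the limit makes them converge. -/
theorem Standing.tendsto_max_nextSurplus (hM : M.Standing p P) (n : ℕ)
    {u : ℕ → ℝ × RetainedLoss} {q : ℝ × RetainedLoss} (hu : Tendsto u atTop (𝓝 q)) (ω : Ω) :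
    Tendsto (fun k => max (M.nextSurplus n q.1 q.2 ω) (M.nextSurplus n (u k).1 (u k).2 ω)) atTop
      (𝓝 (M.nextSurplus n q.1 q.2 ω)) := by
  refine tendsto_order.2 ⟨fun a ha => Eventually.of_forall fun k => ha.trans_le (le_max_left _ _),
    fun a ha => ?_⟩
  have hcont : Tendsto (fun k => (u k).1 + (M.income n ω : ℝ) - ((u k).2 (M.claim n ω) : ℝ)) atTop
      (𝓝 (q.1 + (M.income n ω : ℝ) - (q.2 (M.claim n ω) : ℝ))) := by
    have h1 : Tendsto (fun k => (u k).1) atTop (𝓝 q.1) := (continuous_fst.tendsto q).comp hu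
    have h2 : Tendsto (fun k => ((u k).2 (M.claim n ω) : ℝ)) atTop (𝓝 (q.2 (M.claim n ω))) :=
      ((NNReal.continuous_coe.comp ((RetainedLoss.continuous_eval _).comp
        continuous_snd)).tendsto q).comp hu
    exact (h1.add_const _).sub h2
  set δ : ℝ := (a - M.nextSurplus n q.1 q.2 ω) / 2 with hδ
  have hδ0 : 0 < δ := half_pos (sub_pos.2 ha)
  have hprem : ∀ᶠ k in atTop, (M.reinsurancePremium n q.2).toReal - δ
      < (M.reinsurancePremium n (u k).2).toReal := by
    have hlt : (((M.reinsurancePremium n q.2).toReal - δ : ℝ) : EReal) <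
        liminf (fun k => M.reinsurancePremium n (u k).2) atTop := by
      refine lt_of_lt_of_le ?_
        (hM.reinsurancePremium_le_liminf n ((continuous_snd.tendsto q).comp hu))
      rw [← hM.coe_toReal_reinsurancePremium n q.2, EReal.coe_lt_coe_iff, EReal.toReal_coe]
      linarith
    filter_upwards [eventually_lt_of_lt_liminf hlt] with k hk
    rwa [← hM.coe_toReal_reinsurancePremium n (u k).2, EReal.coe_lt_coe_iff] at hk
  filter_upwards [hprem, hcont.eventually (gt_mem_nhds (lt_add_of_pos_right _ hδ0))] with k h1 h2
  refine max_lt ha ?_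
  simp only [nextSurplus] at hδ ⊢
  linarith

variable [IsProbabilityMeasure P]

theorem isLpRV_effectiveRisk (hM : M.Standing p P) {N n : ℕ} (hn : n < N) {v : ℝ → EReal}
    (hv : M.WithinBounds P N (n + 1) v) (hmeas : Measurable v) (x : ℝ) (f : RetainedLoss) :
    IsLpRV p P (M.effectiveRisk n v x f) := by
  rw [effectiveRisk_eq_stageCost]
  exact hM.isLpRV_of_abs_le n
    ((measurable_stageCost M hmeas).comp (hM.measurable_nextSurplus n x f))
    fun ω => abs_stageCost_comp_le hM hn hv (hM.abs_nextSurplus_le n x f ω)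

/-- The effective risk is at most `a_n Y` plus a constant, by `neg_nextSurplus_le`. -/
theorem opL_le_upperBd (hM : M.Standing p P) {N n : ℕ} (hn : n < N)
    (hN : M.FiniteHorizonAssumption p P N) {v : ℝ → EReal}
    (hv : M.WithinBounds P N (n + 1) v) (hmeas : Measurable v) (x : ℝ) (f : RetainedLoss) :
    M.opL n v x f ≤ (M.upperBd N n x : EReal) := by
  have ha := slope_nonneg hM N n
  have hY := hM.claim_mem n
  have hlY : IsLpRV p P fun ω => M.slope N n * (M.claim n ω : ℝ) :=
    ⟨hY.1.coe_nnreal_real.const_mul _, hY.2.const_mul _⟩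
  set m : ℝ := M.slope N n * (M.premium n (M.claim n)).toReal + M.slope N n * max (-x) 0
    + M.discount * M.upperConst N (n + 1) with hm
  have hub : M.upperBd N n x = (M.risk n fun ω => M.slope N n * (M.claim n ω : ℝ)).toReal + m := by
    rw [upperBd, upperConst, if_pos hn, ← slope_eq M hn, hm]
    ring
  rw [hub, EReal.coe_add, coe_toReal_risk_claim hM hn hN ha,
    ← (hN.risk_measure n hn).translation_invariant _ m hlY]
  refine (hN.risk_measure n hn).monotone _ _ (isLpRV_effectiveRisk hM hn hv hmeas x f)
    ⟨hlY.1.add_const m, hlY.2.add (memLp_const m)⟩ (Eventually.of_forall fun ω => ?_)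
  rw [effectiveRisk_eq_stageCost]
  have h1 := stageCost_le hM hn hv (M.nextSurplus n x f ω)
  have h2 := mul_le_mul_of_nonneg_left (hM.neg_nextSurplus_le n x f ω) ha
  simp only [hm]
  linarith

/-- The effective risk is almost surely at least the constant in which `Z` is replaced by its
essential supremum. -/
theorem lowerBd_le_opL (hM : M.Standing p P) {N n : ℕ} (hn : n < N)
    (hN : M.FiniteHorizonAssumption p P N) {v : ℝ → EReal}
    (hv : M.WithinBounds P N (n + 1) v) (hmeas : Measurable v) (x : ℝ) (f : RetainedLoss) :
    (M.lowerBd P N n x : EReal) ≤ M.opL n v x f := by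
  have ha := slope_nonneg hM N n
  rw [← (hN.risk_measure n hn).apply_const]
  refine (hN.risk_measure n hn).monotone _ _ ⟨measurable_const, memLp_const _⟩
    (isLpRV_effectiveRisk hM hn hv hmeas x f) ?_
  filter_upwards [hM.income_le_essSup n] with ω hω
  rw [effectiveRisk_eq_stageCost, lowerBd, lowerConst, if_pos hn, ← slope_eq M hn]
  have h1 := le_stageCost hM hn hv (M.nextSurplus n x f ω)
  have h2 := mul_le_mul_of_nonneg_left (hM.nextSurplus_le n x f ω) ha
  have h3 := mul_le_mul_of_nonneg_left (NNReal.coe_le_coe.2 hω) ha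
  linarith

/-! ### The operators `L_n` and `𝒯_n` -/

theorem opL_mono (hM : M.Standing p P) {N n : ℕ} (hn : n < N)
    (hN : M.FiniteHorizonAssumption p P N) {v w : ℝ → EReal}
    (hv : M.WithinBounds P N (n + 1) v) (hvm : Measurable v)
    (hw : M.WithinBounds P N (n + 1) w) (hwm : Measurable w) (hvw : ∀ x, v x ≤ w x)
    (x : ℝ) (f : RetainedLoss) : M.opL n v x f ≤ M.opL n w x f := by
  refine (hN.risk_measure n hn).monotone _ _ (isLpRV_effectiveRisk hM hn hv hvm x f)
    (isLpRV_effectiveRisk hM hn hw hwm x f) (Eventually.of_forall fun ω => ?_)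
  simp only [effectiveRisk_eq_stageCost, stageCost]
  have := mul_le_mul_of_nonneg_left
    (EReal.toReal_le_toReal (hvw (M.nextSurplus n x f ω)) (hv.ne_bot _) (hw.ne_top _))
    hM.discount_pos.le
  linarith

theorem opL_antitone (hM : M.Standing p P) {N n : ℕ} (hn : n < N)
    (hN : M.FiniteHorizonAssumption p P N) {v : ℝ → EReal}
    (hv : M.WithinBounds P N (n + 1) v) (hanti : Antitone v) (f : RetainedLoss) :
    Antitone fun x => M.opL n v x f := by
  intro x y hxy
  refine (hN.risk_measure n hn).monotone _ _ (isLpRV_effectiveRisk hM hn hv hanti.measurable y f)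
    (isLpRV_effectiveRisk hM hn hv hanti.measurable x f) (Eventually.of_forall fun ω => ?_)
  simp only [effectiveRisk_eq_stageCost]
  refine antitone_stageCost hM hv hanti ?_
  simp only [nextSurplus]
  linarith

/-- `L_n v` is jointly lower semicontinuous in state and action for decreasing lower
semicontinuous `v`. -/
theorem lowerSemicontinuous_opL (hM : M.Standing p P) {N n : ℕ} (hn : n < N)
    (hN : M.FiniteHorizonAssumption p P N) {v : ℝ → EReal}
    (hv : M.WithinBounds P N (n + 1) v) (hanti : Antitone v) (hlsc : LowerSemicontinuous v) :
    LowerSemicontinuous (Function.uncurry (M.opL n v)) := by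
  refine lowerSemicontinuous_of_le_liminf_seq fun u q hu => ?_
  have hst := measurable_stageCost M hanti.measurable
  have hx : Tendsto (fun k => |(u k).1|) atTop (𝓝 |q.1|) :=
    ((continuous_fst.tendsto q).comp hu).abs
  obtain ⟨R, hR⟩ := hx.bddAbove_range
  have hRk : ∀ k, |(u k).1| ≤ R := fun k => hR ⟨k, rfl⟩
  have hRq : |q.1| ≤ R := le_of_tendsto' hx hRk
  set t : ℕ → Ω → ℝ := fun k ω =>
    max (M.nextSurplus n q.1 q.2 ω) (M.nextSurplus n (u k).1 (u k).2 ω) with ht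
  have htm : ∀ k, Measurable (t k) := fun k =>
    (hM.measurable_nextSurplus n _ _).max (hM.measurable_nextSurplus n _ _)
  have htb : ∀ k ω, |t k ω| ≤ R + (M.premium n (M.claim n)).toReal
      + ((M.claim n ω : ℝ) + (M.income n ω : ℝ)) := by
    intro k ω
    refine abs_max_le_max_abs_abs.trans (max_le ?_ ?_)
    · linarith [hM.abs_nextSurplus_le n q.1 q.2 ω]
    · linarith [hM.abs_nextSurplus_le n (u k).1 (u k).2 ω, hRk k]
  have hLp : ∀ k, IsLpRV p P fun ω => M.stageCost v (t k ω) := fun k =>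
    hM.isLpRV_of_abs_le n (hst.comp (htm k)) fun ω => abs_stageCost_comp_le hM hn hv (htb k ω)
  -- The truncated costs converge and lie below the original ones.
  have hfatou := (hN.risk_measure n hn).fatou (fun k ω => M.stageCost v (t k ω))
    (M.effectiveRisk n v q.1 q.2) _ hLp
    (isLpRV_effectiveRisk hM hn hv hanti.measurable q.1 q.2) (hM.isLpRV_affine n _ _)
    (fun k => Eventually.of_forall fun ω => abs_stageCost_comp_le hM hn hv (htb k ω))
    (Eventually.of_forall fun ω => by
      rw [effectiveRisk_eq_stageCost]
      exact tendsto_stageCost hv hanti hlsc (fun k => le_max_left _ _)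
        (hM.tendsto_max_nextSurplus n hu ω))
  refine hfatou.trans (liminf_le_liminf (Eventually.of_forall fun k => ?_))
  refine (hN.risk_measure n hn).monotone _ _ (hLp k)
    (isLpRV_effectiveRisk hM hn hv hanti.measurable _ _) (Eventually.of_forall fun ω => ?_)
  rw [effectiveRisk_eq_stageCost]
  exact antitone_stageCost hM hv hanti (le_max_right _ _)

theorem opT_withinBounds (hM : M.Standing p P) {N n : ℕ} (hn : n < N)
    (hN : M.FiniteHorizonAssumption p P N) {v : ℝ → EReal}
    (hv : M.WithinBounds P N (n + 1) v) (hmeas : Measurable v) :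
    M.WithinBounds P N n (M.opT n v) := fun x =>
  ⟨le_iInf₂ fun f _ => lowerBd_le_opL hM hn hN hv hmeas x f,
    (iInf₂_le _ (hM.full_mem_admissible n x)).trans (opL_le_upperBd hM hn hN hv hmeas x _)⟩

/-- The Bellman operator maps `𝔹_{n+1}` into `𝔹_n`. -/
theorem opT_mem_classB (hM : M.Standing p P) {N n : ℕ} (hn : n < N)
    (hN : M.FiniteHorizonAssumption p P N) {v : ℝ → EReal} (hv : v ∈ M.classB P N (n + 1)) :
    M.opT n v ∈ M.classB P N n := by
  obtain ⟨hanti, hlsc, hb⟩ := hv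
  refine ⟨fun x y hxy => ?_, ?_, opT_withinBounds hM hn hN hb hanti.measurable⟩
  · exact le_iInf₂ fun f hf => (iInf₂_le f (admissible_mono M n hxy hf)).trans
      (opL_antitone hM hn hN hb hanti f hxy)
  · exact lowerSemicontinuous_iInf_section (hM.isClosed_admissible n)
      (lowerSemicontinuous_opL hM hn hN hb hanti hlsc)

theorem exists_markovRule_opTd_eq_opT (hM : M.Standing p P) {N n : ℕ} (hn : n < N)
    (hN : M.FiniteHorizonAssumption p P N) {v : ℝ → EReal} (hv : v ∈ M.classB P N (n + 1)) :
    ∃ d : M.MarkovRule n, ∀ x, M.opTd n d v x = M.opT n v x := by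
  have hb := (opT_mem_classB hM hn hN hv).2.2
  obtain ⟨hanti, hlsc, hvb⟩ := hv
  obtain ⟨d, hd, hmin⟩ := exists_measurable_argmin
    (φ := fun i f => (f (TopologicalSpace.denseSeq ℝ≥0 i) : ℝ))
    (fun i => NNReal.continuous_coe.comp (RetainedLoss.continuous_eval _))
    (fun f g h => RetainedLoss.ext_denseSeq h) (hM.isClosed_admissible n)
    (lowerSemicontinuous_opL hM hn hN hvb hanti hlsc)
    (fun x => (hb x).2.trans_lt (EReal.coe_lt_top _))
  exact ⟨⟨d, hd, fun x => (hmin x).1⟩, fun x => (hmin x).2⟩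

end ReinsuranceModel

namespace ReinsuranceModel

variable {Ω : Type*} {M : ReinsuranceModel Ω}

/-! ### Recursions for policy values and the Bellman recursion -/

/-- The solution of the Bellman recursion: zero at the horizon, and `𝒯_n` applied to the next
function before. -/
noncomputable def bellmanFn (M : ReinsuranceModel Ω) (N n : ℕ) : ℝ → EReal :=
  if n < N then M.opT n (bellmanFn M N (n + 1)) else fun _ => 0
termination_by N - n

theorem bellmanFn_of_lt (M : ReinsuranceModel Ω) {N n : ℕ} (hn : n < N) :
    M.bellmanFn N n = M.opT n (M.bellmanFn N (n + 1)) := by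
  rw [bellmanFn, if_pos hn]

theorem bellmanFn_self (M : ReinsuranceModel Ω) (N : ℕ) : M.bellmanFn N N = fun _ => 0 := by
  rw [bellmanFn, if_neg (lt_irrefl N)]

theorem Hist.current_extend {n : ℕ} (h : M.Hist n) (f : RetainedLoss)
    (hf : f ∈ M.admissible n h.current) (x' : ℝ) : (h.extend f hf x').current = x' := by
  simp [Hist.current, Hist.extend]

theorem policyValue_of_lt {N : ℕ} (pol : M.Policy N) {n : ℕ} (hn : n < N) (h : M.Hist n) :
    M.policyValue pol n h = M.opL n
      (fun x' => M.policyValue pol (n + 1)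
        (h.extend ((pol ⟨n, hn⟩).act h) ((pol ⟨n, hn⟩).feasible h) x'))
      h.current ((pol ⟨n, hn⟩).act h) := by
  rw [policyValue, dif_pos hn]

theorem policyValue_self {N : ℕ} (pol : M.Policy N) (h : M.Hist N) :
    M.policyValue pol N h = 0 := by
  rw [policyValue, dif_neg (lt_irrefl N)]

theorem markovPolicyValue_of_lt {N : ℕ} (pol : M.MarkovPolicy N) {n : ℕ} (hn : n < N) :
    M.markovPolicyValue pol n = M.opTd n (pol ⟨n, hn⟩) (M.markovPolicyValue pol (n + 1)) := by
  funext x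
  rw [markovPolicyValue, dif_pos hn]

theorem markovPolicyValue_self {N : ℕ} (pol : M.MarkovPolicy N) :
    M.markovPolicyValue pol N = fun _ => 0 := by
  funext x
  rw [markovPolicyValue, dif_neg (lt_irrefl N)]

theorem policyValue_toPolicy {N : ℕ} (pol : M.MarkovPolicy N) {n : ℕ} (hn : n ≤ N)
    (h : M.Hist n) : M.policyValue pol.toPolicy n h = M.markovPolicyValue pol n h.current := by
  induction hn using Nat.decreasingInduction with
  | of_succ n hn ih =>
    rw [policyValue_of_lt _ hn, markovPolicyValue_of_lt _ hn]
    simp only [ih, Hist.current_extend]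
    rfl
  | self => rw [policyValue_self, markovPolicyValue_self]

theorem Hist.measurable_extend {n : ℕ} (h : M.Hist n) (f : RetainedLoss)
    (hf : f ∈ M.admissible n h.current) : Measurable (h.extend f hf) := by
  refine Measurable.subtype_mk (Measurable.prodMk (measurable_pi_iff.2 fun k => ?_)
    measurable_const)
  refine Fin.lastCases ?_ (fun j => ?_) k
  · simpa only [Fin.snoc_last] using measurable_id'
  · simp only [Fin.snoc_castSucc, measurable_const]

theorem measurable_policyValue_extend {N n : ℕ} {pol : M.Policy N}
    (hmeas : Measurable (M.policyValue pol (n + 1))) (h : M.Hist n) (f : RetainedLoss)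
    (hf : f ∈ M.admissible n h.current) :
    Measurable fun x' => M.policyValue pol (n + 1) (h.extend f hf x') :=
  hmeas.comp (h.measurable_extend f hf)

theorem upperBd_self (M : ReinsuranceModel Ω) (N : ℕ) (x : ℝ) : M.upperBd N N x = 0 := by
  simp [upperBd, upperConst, slope]

theorem markovPolicyValue_eq_bellmanFn {N : ℕ} {pol : M.MarkovPolicy N}
    (hpol : ∀ (n : Fin N) (x : ℝ), M.opTd n (pol n) (M.bellmanFn N (n + 1)) x
      = M.opT n (M.bellmanFn N (n + 1)) x) {n : ℕ} (hn : n ≤ N) :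
    M.markovPolicyValue pol n = M.bellmanFn N n := by
  induction hn using Nat.decreasingInduction with
  | of_succ n hn ih =>
    rw [markovPolicyValue_of_lt pol hn, ih, bellmanFn_of_lt M hn]
    exact funext (hpol ⟨n, hn⟩)
  | self => rw [markovPolicyValue_self, bellmanFn_self]

variable [MeasurableSpace Ω] {P : Measure Ω} {p : ℝ≥0∞}

/-! ### Verification and optimality -/

/-- The history that is constantly in state `x`, with full retention throughout. -/
noncomputable def Standing.constHist (hM : M.Standing p P) (n : ℕ) (x : ℝ) : M.Hist n :=
  ⟨(fun _ => x, fun _ => RetainedLoss.full), fun k => hM.full_mem_admissible k x⟩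

theorem withinBounds_policyValue_extend {N n : ℕ} {pol : M.Policy N}
    (hb : ∀ h : M.Hist (n + 1), (M.lowerBd P N (n + 1) h.current : EReal) ≤
      M.policyValue pol (n + 1) h ∧
      M.policyValue pol (n + 1) h ≤ (M.upperBd N (n + 1) h.current : EReal))
    (h : M.Hist n) (f : RetainedLoss) (hf : f ∈ M.admissible n h.current) :
    M.WithinBounds P N (n + 1) fun x' => M.policyValue pol (n + 1) (h.extend f hf x') := by
  intro x'
  simpa only [Hist.current_extend] using hb (h.extend f hf x')

variable [IsProbabilityMeasure P]

theorem lowerBd_self (M : ReinsuranceModel Ω) (P : Measure Ω) (N : ℕ) (x : ℝ) :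
    M.lowerBd P N N x = 0 := by
  simp [lowerBd, lowerConst, slope]

theorem bellmanFn_mem_classB (hM : M.Standing p P) {N : ℕ}
    (hN : M.FiniteHorizonAssumption p P N) {n : ℕ} (hn : n ≤ N) :
    M.bellmanFn N n ∈ M.classB P N n := by
  induction hn using Nat.decreasingInduction with
  | of_succ n hn ih =>
    rw [bellmanFn_of_lt M hn]
    exact opT_mem_classB hM hn hN ih
  | self =>
    rw [bellmanFn_self]
    exact ⟨antitone_const, lowerSemicontinuous_const, fun x => by
      simp [lowerBd_self, upperBd_self]⟩

theorem policyValue_bounds (hM : M.Standing p P) {N : ℕ}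
    (hN : M.FiniteHorizonAssumption p P N) {pol : M.Policy N}
    (hmeas : ∀ n ≤ N, Measurable (M.policyValue pol n)) {n : ℕ} (hn : n ≤ N) (h : M.Hist n) :
    (M.lowerBd P N n h.current : EReal) ≤ M.policyValue pol n h ∧
      M.policyValue pol n h ≤ (M.upperBd N n h.current : EReal) := by
  induction hn using Nat.decreasingInduction with
  | of_succ n hn ih =>
    rw [policyValue_of_lt pol hn]
    have hb := withinBounds_policyValue_extend ih h _ ((pol ⟨n, hn⟩).feasible h)
    have hm := measurable_policyValue_extend (hmeas (n + 1) hn) h _ ((pol ⟨n, hn⟩).feasible h)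
    exact ⟨lowerBd_le_opL hM hn hN hb hm _ _, opL_le_upperBd hM hn hN hb hm _ _⟩
  | self => simp [policyValue_self, lowerBd_self, upperBd_self]

/-- Verification: no policy, Markov or not, does better than the Bellman recursion. -/
theorem bellmanFn_le_policyValue (hM : M.Standing p P) {N : ℕ}
    (hN : M.FiniteHorizonAssumption p P N) {pol : M.Policy N}
    (hmeas : ∀ n ≤ N, Measurable (M.policyValue pol n)) {n : ℕ} (hn : n ≤ N) (h : M.Hist n) :
    M.bellmanFn N n h.current ≤ M.policyValue pol n h := by
  induction hn using Nat.decreasingInduction with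
  | of_succ n hn ih =>
    rw [policyValue_of_lt pol hn, bellmanFn_of_lt M hn]
    have hB := bellmanFn_mem_classB hM hN hn
    refine (iInf₂_le _ ((pol ⟨n, hn⟩).feasible h)).trans (opL_mono hM hn hN hB.2.2
      hB.1.measurable
      (withinBounds_policyValue_extend (fun h => policyValue_bounds hM hN hmeas hn h) h _ _)
      (measurable_policyValue_extend (hmeas (n + 1) hn) h _ _) (fun x' => ?_) _ _)
    simpa only [Hist.current_extend] using
      ih (h.extend _ ((pol ⟨n, hn⟩).feasible h) x')
  | self => rw [policyValue_self, bellmanFn_self]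

theorem exists_markovPolicy_minimizing (hM : M.Standing p P) {N : ℕ}
    (hN : M.FiniteHorizonAssumption p P N) :
    ∃ pol : M.MarkovPolicy N, ∀ (n : Fin N) (x : ℝ), M.opTd n (pol n) (M.bellmanFn N (n + 1)) x
      = M.opT n (M.bellmanFn N (n + 1)) x := by
  choose pol hpol using fun n : Fin N =>
    exists_markovRule_opTd_eq_opT hM n.2 hN (bellmanFn_mem_classB hM hN n.2)
  exact ⟨pol, hpol⟩

theorem valueFn_eq_bellmanFn (hM : M.Standing p P) {N : ℕ}
    (hN : M.FiniteHorizonAssumption p P N)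
    (hmeas : ∀ (pol : M.Policy N) (n : ℕ), n ≤ N → Measurable (M.policyValue pol n))
    {n : ℕ} (hn : n ≤ N) (h : M.Hist n) : M.valueFn N n h = M.bellmanFn N n h.current := by
  obtain ⟨pol, hpol⟩ := exists_markovPolicy_minimizing hM hN
  refine le_antisymm ((iInf_le _ pol.toPolicy).trans_eq ?_)
    (le_iInf fun pol' => bellmanFn_le_policyValue hM hN (hmeas pol') hn h)
  rw [policyValue_toPolicy pol hn, markovPolicyValue_eq_bellmanFn hpol hn]

/-- Every state is the current state of some history, so the bound for all policies also bounds the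
values of Markov policies. -/
theorem markovValueFn_eq_bellmanFn (hM : M.Standing p P) {N : ℕ}
    (hN : M.FiniteHorizonAssumption p P N)
    (hmeas : ∀ (pol : M.Policy N) (n : ℕ), n ≤ N → Measurable (M.policyValue pol n))
    {n : ℕ} (hn : n ≤ N) : M.markovValueFn N n = M.bellmanFn N n := by
  obtain ⟨pol, hpol⟩ := exists_markovPolicy_minimizing hM hN
  funext x
  refine le_antisymm ((iInf_le _ pol).trans_eq ?_) (le_iInf fun pol' => ?_)
  · rw [markovPolicyValue_eq_bellmanFn hpol hn]
  · have := bellmanFn_le_policyValue hM hN (hmeas pol'.toPolicy) hn (hM.constHist n x)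
    rwa [policyValue_toPolicy pol' hn] at this

end ReinsuranceModel

theorem mainTheorem1 {Ω : Type*} [MeasurableSpace Ω] (P : Measure Ω) [IsProbabilityMeasure P]
    (p : ℝ≥0∞) (hp1 : 1 ≤ p) (hp : p ≠ ∞)
    (M : ReinsuranceModel Ω) (hM : M.Standing p P)
    (N : ℕ) (hN : M.FiniteHorizonAssumption p P N)
    -- the risk measures are such that all policy values are measurable
    (hmeas : ∀ (pol : M.Policy N) (n : ℕ), n ≤ N → Measurable (M.policyValue pol n)) :
    -- policy values are well defined: the risk measures are applied to elements of `L^p` only,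
    -- and all policy values are finite
    (∀ (pol : M.Policy N) (n : Fin N) (h : M.Hist n),
      IsLpRV p P (M.effectiveRisk n
        (fun x' => M.policyValue pol (n + 1) (h.extend ((pol n).act h) ((pol n).feasible h) x'))
        h.current ((pol n).act h)) ∧
      M.policyValue pol n h ≠ ⊥ ∧ M.policyValue pol n h ≠ ⊤) ∧
    -- the value function depends on the current state only
    (∀ n ≤ N, ∀ h : M.Hist n, M.valueFn N n h = M.markovValueFn N n h.current) ∧
    -- it lies in `𝔹_n`
    (∀ n ≤ N, M.markovValueFn N n ∈ M.classB P N n) ∧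
    -- Bellman equation
    (∀ x, M.markovValueFn N N x = 0) ∧
    (∀ n < N, ∀ x, M.markovValueFn N n x = M.opT n (M.markovValueFn N (n + 1)) x) ∧
    -- existence of minimizing Markov decision rules
    (∀ n < N, ∃ d : M.MarkovRule n,
      ∀ x, M.opTd n d (M.markovValueFn N (n + 1)) x = M.opT n (M.markovValueFn N (n + 1)) x) ∧
    -- every sequence of minimizers is an optimal policy
    (∀ pol : M.MarkovPolicy N,
      (∀ (n : Fin N) (x : ℝ), M.opTd n (pol n) (M.markovValueFn N (n + 1)) x
        = M.opT n (M.markovValueFn N (n + 1)) x) →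
      ∀ n ≤ N, ∀ h : M.Hist n,
        M.policyValue pol.toPolicy n h = M.valueFn N n h) := by
  have hJ : ∀ n ≤ N, M.markovValueFn N n = M.bellmanFn N n := fun n hn =>
    ReinsuranceModel.markovValueFn_eq_bellmanFn hM hN hmeas hn
  refine ⟨fun pol n h => ?_, fun n hn h => ?_, fun n hn => ?_, fun x => ?_, fun n hn x => ?_,
    fun n hn => ?_, fun pol hpol n hn h => ?_⟩
  · have hb := fun {k : ℕ} (hk : k ≤ N) (h : M.Hist k) =>
      ReinsuranceModel.policyValue_bounds hM hN (hmeas pol) hk h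
    refine ⟨ReinsuranceModel.isLpRV_effectiveRisk hM n.2
      (ReinsuranceModel.withinBounds_policyValue_extend (hb n.2) h _ _)
      (ReinsuranceModel.measurable_policyValue_extend (hmeas pol _ n.2) h _ _) _ _, ?_, ?_⟩
    · exact ne_bot_of_le_ne_bot (EReal.coe_ne_bot _) (hb n.2.le h).1
    · exact ne_top_of_le_ne_top (EReal.coe_ne_top _) (hb n.2.le h).2
  · rw [hJ n hn, ReinsuranceModel.valueFn_eq_bellmanFn hM hN hmeas hn]
  · rw [hJ n hn]
    exact ReinsuranceModel.bellmanFn_mem_classB hM hN hn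
  · rw [hJ N le_rfl, ReinsuranceModel.bellmanFn_self]
  · rw [hJ n hn.le, hJ (n + 1) hn, ReinsuranceModel.bellmanFn_of_lt M hn]
  · rw [hJ (n + 1) hn]
    exact ReinsuranceModel.exists_markovRule_opTd_eq_opT hM hn hN
      (ReinsuranceModel.bellmanFn_mem_classB hM hN hn)
  · have hpol' : ∀ (n : Fin N) (x : ℝ), M.opTd n (pol n) (M.bellmanFn N (n + 1)) x
        = M.opT n (M.bellmanFn N (n + 1)) x := fun n x => by
      rw [← hJ (n + 1) n.2]
      exact hpol n x
    rw [ReinsuranceModel.policyValue_toPolicy pol hn,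
      ReinsuranceModel.markovPolicyValue_eq_bellmanFn hpol' hn,
      ReinsuranceModel.valueFn_eq_bellmanFn hM hN hmeas hn]
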